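/- Let $X$ be a set. An orthogonality relation on the subsets of $X$ is a symmetric relation $\perp$ with $\emptyset\perp X$ and $A\perp(C\cup C')\iff(A\perp C$ and $A\perp C')$. A set $B\subseteq X$ is $\perp$-bounded if $B\perp X$, and $\perp$-unbounded otherwise. The relation $\perp$ is normal if (i) $\{x\}\perp\{y\}$ whenever $x\ne y$; (ii) whenever $C\perp D$ there are $C',D'$ with $X=C'\cup D'$, $C'\perp D$ and $D'\perp C$; (iii) $B\perp B$ implies that $B$ is $\perp$-bounded. A function $f:X\to[0,1]$ is $\perp$-continuous if $f^{-1}(A)\perp f^{-1}(C)$ for all $A,C\subseteq[0,1]$ with disjoint closures. A $\perp$-zero-set ($\perp$-cozero-set) is a set $f^{-1}(0)$ (respectively $f^{-1}(0,1]$) with $f:X\to[0,1]$ $\perp$-continuous. Let $\partial_0X$ be the set of all ultrafilters of $\perp$-unbounded $\perp$-zero-sets, that is, of all maximal elements among the filters in the lattice of $\perp$-zero-sets whose members are all $\perp$-unbounded. In $X\cup\partial_0X$ an ultrafilter in $\partial_0X$ that contains every $\perp$-zero-set containing a given point $x\in X$ is identified with $x$. For $C\subseteq X$ let $\bar C\subseteq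 X\cup\partial_0X$ be the union of $C$ and of all ultrafilters in $\partial_0X$ that contain a subset of $C$, and give $X\cup\partial_0X$ the topology with basis $\{\bar U: U\text{ a }\perp\text{-cozero-set}\}$. For $\mathcal F_1,\mathcal F_2\in\partial_0X$ write $\mathcal F_1\sim\mathcal F_2$ if no $C\in\mathcal F_1$ is $\perp$-orthogonal to any $D\in\mathcal F_2$. A topological space $Y$ with a selected family $\mathcal B$ of open-closed subsets that is closed under finite unions and under passing to subsets is called large scale compact if every open cover of $Y$ has a finite subfamily whose union has its complement in $\mathcal B$. Proposition 13.14. Let $\perp$ be a normal orthogonality relation on $X$. Then $\sim$ is an equivalence relation on $\partial_0X$, and so is the relation on $X\cup\partial_0X$ that consists of $\sim$ and equality. The points of $X$ remain distinct in the quotient space $\bar X=X\cup\partial X$ of $X\cup\partial_0X$ under this relation, so $X\subseteq\bar X$. The space $\bar X$, with the family of $\perp$-bounded subsets of $X$ as its selected family (in particular these are open-closed in $\bar X$), is large scale compact, and it is Hausdorff. Moreover, two subsets $C$ and $D$ of $X$ are $\perp$-orthogonal if and only if the intersection of their closures in $\bar X$ is contained in $X$ and is $\perp$-bounded. -/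

import Mathlib

universe u v

/-- An orthogonality relation on the subsets of `X`: a symmetric relation with `∅ ⊥ X` and
`A ⊥ (C ∪ C') ↔ A ⊥ C ∧ A ⊥ C'`. -/
structure Orthogonality (X : Type u) where
  Orth : Set X → Set X → Prop
  symm : ∀ {A C : Set X}, Orth A C → Orth C A
  empty_univ : Orth ∅ Set.univ
  union_iff : ∀ A C C' : Set X, Orth A (C ∪ C') ↔ Orth A C ∧ Orth A C'

namespace Orthogonality

variable {X : Type u} {Y : Type v}

/-- The topological orthogonality relation: disjointness of closures. -/
def topological (Y : Type v) [TopologicalSpace Y] : Orthogonality Y where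
  Orth A C := closure A ∩ closure C = ∅
  symm h := by rwa [Set.inter_comm]
  empty_univ := by simp
  union_iff A C C' := by
    rw [closure_union, Set.inter_union_distrib_left, Set.union_empty_iff]

/-- A set is bounded if it is orthogonal to the whole space. -/
def Bdd (O : Orthogonality X) (B : Set X) : Prop := O.Orth B Set.univ

/-- `C` and `D` span `X`. -/
def Span (O : Orthogonality X) (C D : Set X) : Prop :=
  O.Orth C D ∧ ∃ C' D' : Set X, C' ∪ D' = Set.univ ∧ O.Orth C' D ∧ O.Orth D' C

/-- Normal orthogonality relations. -/
structure IsNormal (O : Orthogonality X) : Prop where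
  frechet : ∀ x y : X, x ≠ y → O.Orth {x} {y}
  span : ∀ C D : Set X, O.Orth C D → O.Span C D
  bdd_of_self : ∀ B : Set X, O.Orth B B → O.Bdd B

/-- `f` is continuous with respect to two orthogonality relations. -/
def Cont (OX : Orthogonality X) (OY : Orthogonality Y) (f : X → Y) : Prop :=
  ∀ A C : Set Y, OY.Orth A C → OX.Orth (f ⁻¹' A) (f ⁻¹' C)

/-- Zero-sets `f⁻¹(0)` of continuous functions to `[0,1]` (with topological orthogonality). -/
def IsZeroSet (O : Orthogonality X) (A : Set X) : Prop :=
  ∃ f : X → unitInterval, O.Cont (topological unitInterval) f ∧ A = f ⁻¹' {0}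

/-- Cozero-sets `f⁻¹(0,1]` of continuous functions to `[0,1]`. -/
def IsCozeroSet (O : Orthogonality X) (A : Set X) : Prop :=
  ∃ f : X → unitInterval, O.Cont (topological unitInterval) f ∧ A = f ⁻¹' Set.Ioc 0 1

/-- Filters, in the lattice of zero-sets, all of whose members are unbounded. -/
structure IsUnboundedZeroFilter (O : Orthogonality X) (F : Set (Set X)) : Prop where
  univ_mem : Set.univ ∈ F
  isZeroSet : ∀ Z ∈ F, O.IsZeroSet Z
  unbounded : ∀ Z ∈ F, ¬ O.Bdd Z
  superset : ∀ Z ∈ F, ∀ W : Set X, Z ⊆ W → O.IsZeroSet W → W ∈ F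
  inter : ∀ Z ∈ F, ∀ W ∈ F, Z ∩ W ∈ F

/-- `∂₀X`: the ultrafilters (maximal filters) of unbounded zero-sets. -/
def Boundary₀ (O : Orthogonality X) : Type u :=
  {F : Set (Set X) // Maximal O.IsUnboundedZeroFilter F}

/-- `F` is the principal ultrafilter at `x`: it contains all zero-sets containing `x`. -/
def PrincipalAt (O : Orthogonality X) (F : O.Boundary₀) (x : X) : Prop :=
  ∀ Z : Set X, O.IsZeroSet Z → x ∈ Z → Z ∈ F.1

/-- The relation `∼` on `∂₀X`. -/
def Sim (O : Orthogonality X) (F₁ F₂ : O.Boundary₀) : Prop :=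
  ∀ C ∈ F₁.1, ∀ D ∈ F₂.1, ¬ O.Orth C D

/-- `X ∪ ∂₀X`, where the principal ultrafilter at `x`, if there is one in `∂₀X`, is identified
with the point `x`; so besides the points of `X` only the non-principal ultrafilters are added. -/
def Precomp (O : Orthogonality X) : Type u :=
  X ⊕ {F : O.Boundary₀ // ∀ x : X, ¬ O.PrincipalAt F x}

/-- The ultrafilter `F ∈ ∂₀X` is, after the identification, the point `p` of `X ∪ ∂₀X`. -/
def Represents (O : Orthogonality X) (F : O.Boundary₀) : O.Precomp → Prop
  | Sum.inl x => O.PrincipalAt F x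
  | Sum.inr G => F = G.1

/-- For `C ⊆ X`, the union in `X ∪ ∂₀X` of `C` and of all ultrafilters containing a subset
of `C`. -/
def bar (O : Orthogonality X) (C : Set X) : Set O.Precomp :=
  {p | (∃ x ∈ C, p = Sum.inl x) ∨ ∃ F : O.Boundary₀, O.Represents F p ∧ ∃ Z ∈ F.1, Z ⊆ C}

/-- The topology of `X ∪ ∂₀X` with the sets `bar U`, `U` a cozero-set, as its basis. -/
instance (O : Orthogonality X) : TopologicalSpace O.Precomp :=
  TopologicalSpace.generateFrom {V | ∃ U : Set X, O.IsCozeroSet U ∧ V = O.bar U}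

/-- The relation `∼`, carried over to `X ∪ ∂₀X`. -/
def PrecompRel (O : Orthogonality X) (p q : O.Precomp) : Prop :=
  p = q ∨ ∃ F G : O.Boundary₀, O.Represents F p ∧ O.Represents G q ∧ O.Sim F G

/-- The quotient space `X ∪ ∂X` of `X ∪ ∂₀X`. -/
def Compactification (O : Orthogonality X) : Type u := Quot O.PrecompRel

/-- The quotient topology. -/
instance (O : Orthogonality X) : TopologicalSpace O.Compactification :=
  inferInstanceAs (TopologicalSpace (Quot O.PrecompRel))

/-- The canonical map from `X` to `X ∪ ∂X`. -/
def toCompactification (O : Orthogonality X) (x : X) : O.Compactification :=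
  Quot.mk _ (Sum.inl x : O.Precomp)

end Orthogonality

/-- A selected bornology of open-closed subsets turns a topological space into a large scale
topological space. (A bornology is not required to cover the space.) -/
structure IsLargeScaleSpace (Y : Type u) [TopologicalSpace Y] (𝓑 : Set (Set Y)) : Prop where
  subset : ∀ B' ∈ 𝓑, ∀ B : Set Y, B ⊆ B' → B ∈ 𝓑
  union : ∀ B ∈ 𝓑, ∀ B' ∈ 𝓑, B ∪ B' ∈ 𝓑
  isClopen : ∀ B ∈ 𝓑, IsClopen B

/-- Large scale compact spaces: every open cover has a finite subfamily that covers the space up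
to a member of the bornology. -/
structure IsLargeScaleCompact (Y : Type u) [TopologicalSpace Y] (𝓑 : Set (Set Y)) : Prop
    extends IsLargeScaleSpace Y 𝓑 where
  finite_cover : ∀ 𝒰 : Set (Set Y), (∀ U ∈ 𝒰, IsOpen U) → ⋃₀ 𝒰 = Set.univ →
    ∃ 𝓕 : Set (Set Y), 𝓕 ⊆ 𝒰 ∧ 𝓕.Finite ∧ (⋃₀ 𝓕)ᶜ ∈ 𝓑

namespace Orthogonality

open Set Filter Topology

variable {X : Type u} {O : Orthogonality X}

/-! ### Elementary properties -/

/-! The engine is a Urysohn lemma: by normality, disjoint orthogonal sets are separated by a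
⊥-continuous function to [0,1] (`IsNormal.exists_uCont`). Orthogonal sets that meet do so in a
bounded set. Complements of bounded sets are zero-sets and lie in every ultrafilter of ∂₀X, so such
an intersection can be discarded.

A ⊥-continuous function has a limit along each ultrafilter, and two ultrafilters are ∼-related
exactly when all these limits agree (`IsNormal.sim_iff`); transitivity of ∼ follows. The limits also
extend the function continuously to the quotient (`UCont.exists_extension`). These extensions
separate points, and they force the closures of orthogonal sets `C`, `D` to meet only in the bounded
set `C ∩ D`.

Large scale compactness is the usual ultrafilter argument: a cover without a good finite subfamily
yields, by Zorn's lemma, an ultrafilter whose point is not covered. Finally, if `C` and `D` are not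
orthogonal, there are set ultrafilters through `C` and `D` with no orthogonal members. Their
zero-sets extend to ∼-related elements of ∂₀X, whose common class lies in both closures and is not a
bounded point. -/

theorem Orth.mono_right {A C D : Set X} (h : O.Orth A D) (hCD : C ⊆ D) : O.Orth A C := by
  rw [← union_eq_self_of_subset_left hCD, O.union_iff] at h
  exact h.1

theorem Orth.mono_left {A B C : Set X} (h : O.Orth B C) (hAB : A ⊆ B) : O.Orth A C :=
  O.symm ((O.symm h).mono_right hAB)

theorem Orth.mono {A B C D : Set X} (h : O.Orth B D) (hAB : A ⊆ B) (hCD : C ⊆ D) :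
    O.Orth A C :=
  (h.mono_left hAB).mono_right hCD

theorem Orth.union_right {A C D : Set X} (h : O.Orth A C) (h' : O.Orth A D) :
    O.Orth A (C ∪ D) :=
  (O.union_iff _ _ _).2 ⟨h, h'⟩

theorem Orth.union_left {A B C : Set X} (h : O.Orth A C) (h' : O.Orth B C) :
    O.Orth (A ∪ B) C :=
  O.symm ((O.symm h).union_right (O.symm h'))

variable (O) in
theorem orth_empty_left (A : Set X) : O.Orth ∅ A := Orth.mono_right O.empty_univ (subset_univ A)

variable (O) in
theorem orth_empty_right (A : Set X) : O.Orth A ∅ := O.symm (O.orth_empty_left A)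

theorem Bdd.orth {B : Set X} (h : O.Bdd B) (A : Set X) : O.Orth B A :=
  Orth.mono_right h (subset_univ A)

theorem Bdd.mono {A B : Set X} (h : O.Bdd B) (hAB : A ⊆ B) : O.Bdd A := Orth.mono_left h hAB

theorem Bdd.union {A B : Set X} (hA : O.Bdd A) (hB : O.Bdd B) : O.Bdd (A ∪ B) :=
  Orth.union_left hA hB

variable (O) in
theorem bdd_empty : O.Bdd ∅ := O.empty_univ

theorem IsNormal.bdd_inter (hO : O.IsNormal) {C D : Set X} (h : O.Orth C D) : O.Bdd (C ∩ D) :=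
  hO.bdd_of_self _ (h.mono inter_subset_left inter_subset_right)

/-! ### Urysohn's lemma -/

/-- Sublevel sets and superlevel sets at different levels are orthogonal. -/
def LevelSep (O : Orthogonality X) (f : X → ℝ) : Prop :=
  ∀ a b : ℝ, a < b → O.Orth {x | f x ≤ a} {x | b ≤ f x}

section Urysohn

open Urysohns

variable [TopologicalSpace X]

/-- The set `c.left.U` cuts the function in two: on it only the left half contributes, off it the
left half is already 1. Level sets on one side of 1/2 thus become level sets of one half at doubled
scale, which drives the inductions below. -/
theorem lim_cases (c : CU fun C U : Set X => O.Orth C Uᶜ) (x : X) :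
    (x ∈ c.left.U ∧ c.right.lim x = 0 ∧ c.lim x = c.left.lim x / 2) ∨
      (x ∉ c.left.U ∧ c.left.lim x = 1 ∧ c.lim x = (1 + c.right.lim x) / 2) := by
  have h := c.lim_eq_midpoint x
  rw [midpoint_eq_smul_add, smul_eq_mul, invOf_eq_inv] at h
  by_cases hx : x ∈ c.left.U
  · have h0 := c.right.lim_of_mem_C x (c.left_U_subset_right_C hx)
    exact Or.inl ⟨hx, h0, by rw [h, h0]; ring⟩
  · have h1 := c.left.lim_of_notMem_U x hx
    exact Or.inr ⟨hx, h1, by rw [h, h1]; ring⟩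

theorem left_left_U_orth (c : CU fun C U : Set X => O.Orth C Uᶜ) :
    O.Orth c.left.left.U c.left.Uᶜ :=
  Orth.mono_left c.left.right.P_C_U c.left.left_U_subset_right_C

theorem orth_lim_zero (n : ℕ) : ∀ (c : CU fun C U : Set X => O.Orth C Uᶜ) (b : ℝ),
    1 < 2 ^ n * b → O.Orth {x | c.lim x ≤ 0} {x | b ≤ c.lim x} := by
  induction n with
  | zero =>
    intro c b hb
    refine (O.orth_empty_right _).mono_right fun x hx => ?_
    have := c.lim_le_one x
    simp only [mem_ofPred_eq] at hx
    linarith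
  | succ n ih =>
    intro c b hb
    rcases le_or_gt b (1 / 2) with h | h
    · refine (ih c.left (2 * b) (by rw [pow_succ] at hb; linarith)).mono ?_ ?_ <;> intro x hx <;>
        simp only [mem_ofPred_eq] at hx ⊢ <;> have := c.right.lim_nonneg x <;>
        rcases lim_cases c x with ⟨_, h0, h1⟩ | ⟨_, h0, h1⟩ <;> linarith
    -- The function is at least 1/4 off `c.left.left.U` and at most 1/2 on `c.left.U`, so this
    -- nested pair separates the two levels.
    · refine (left_left_U_orth c).mono ?_ ?_ <;> intro x hx <;>
        simp only [mem_ofPred_eq, mem_compl_iff] at hx ⊢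
      · by_contra hx'
        have h2 := c.left.left.lim_of_notMem_U x hx'
        have := c.right.lim_nonneg x
        have := c.left.right.lim_nonneg x
        rcases lim_cases c x with ⟨_, h0, h1⟩ | ⟨_, h0, h1⟩ <;>
        rcases lim_cases c.left x with ⟨_, h0', h1'⟩ | ⟨_, h0', h1'⟩ <;> linarith
      · intro hx'
        have := c.left.lim_le_one x
        rcases lim_cases c x with ⟨_, h0, h1⟩ | ⟨h0, _, h1⟩
        · linarith
        · exact h0 hx'

/-- The gap `b - a` doubles on passing to a half; once it exceeds 1, one of the two level sets is
empty. -/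
theorem levelSep_lim_aux (n : ℕ) : ∀ (c : CU fun C U : Set X => O.Orth C Uᶜ) (a b : ℝ),
    1 < 2 ^ n * (b - a) → O.Orth {x | c.lim x ≤ a} {x | b ≤ c.lim x} := by
  induction n with
  | zero =>
    intro c a b hb
    rcases lt_or_ge a 0 with ha | ha
    · refine (O.orth_empty_left _).mono_left fun x hx => ?_
      have := c.lim_nonneg x
      simp only [mem_ofPred_eq] at hx
      linarith
    · refine (O.orth_empty_right _).mono_right fun x hx => ?_
      have := c.lim_le_one x
      simp only [mem_ofPred_eq] at hx
      linarith
  | succ n ih =>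
    intro c a b hb
    rw [pow_succ] at hb
    rcases le_or_gt b (1 / 2) with h | h
    · refine (ih c.left (2 * a) (2 * b) (by linarith)).mono ?_ ?_ <;> intro x hx <;>
        simp only [mem_ofPred_eq] at hx ⊢ <;> have := c.right.lim_nonneg x <;>
        rcases lim_cases c x with ⟨_, h0, h1⟩ | ⟨_, h0, h1⟩ <;> linarith
    rcases le_or_gt (1 / 2) a with h' | h'
    · refine (ih c.right (2 * a - 1) (2 * b - 1) (by linarith)).mono ?_ ?_ <;> intro x hx <;>
        simp only [mem_ofPred_eq] at hx ⊢ <;> have := c.left.lim_le_one x <;>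
        rcases lim_cases c x with ⟨_, h0, h1⟩ | ⟨_, h0, h1⟩ <;> linarith
    -- When the levels straddle 1/2, the right half vanishes on the lower set and is at least `2 * b
    -- - 1 > 0` on the upper one, so `orth_lim_zero` applies.
    · obtain ⟨m, hm⟩ := pow_unbounded_of_one_lt (1 / (2 * b - 1)) (one_lt_two (α := ℝ))
      rw [div_lt_iff₀ (by linarith)] at hm
      refine (orth_lim_zero m c.right (2 * b - 1) hm).mono ?_ ?_ <;> intro x hx <;>
        simp only [mem_ofPred_eq] at hx ⊢ <;> have := c.left.lim_le_one x <;>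
        rcases lim_cases c x with ⟨_, h0, h1⟩ | ⟨_, h0, h1⟩ <;> linarith

theorem levelSep_lim (c : CU fun C U : Set X => O.Orth C Uᶜ) : O.LevelSep c.lim := by
  intro a b hab
  obtain ⟨m, hm⟩ := pow_unbounded_of_one_lt (1 / (b - a)) (one_lt_two (α := ℝ))
  rw [div_lt_iff₀ (by linarith)] at hm
  exact levelSep_lim_aux m c a b hm

end Urysohn

theorem IsNormal.exists_between (hO : O.IsNormal) {c u : Set X} (h : O.Orth c uᶜ)
    (hcu : c ⊆ u) : ∃ v, c ⊆ v ∧ v ⊆ u ∧ O.Orth c vᶜ ∧ O.Orth v uᶜ := by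
  obtain ⟨-, C', D', hCD, hC, hD⟩ := hO.span _ _ h
  -- `C'` need not lie between `c` and `u`; adding `c` and cutting down to `u` keeps both
  -- orthogonalities, as the new complement lies in `D' ∪ uᶜ`.
  refine ⟨(C' ∪ c) ∩ u, subset_inter subset_union_right hcu, inter_subset_right, ?_,
    (hC.union_left h).mono_left inter_subset_left⟩
  refine ((O.symm hD).union_right h).mono_right fun x hx => ?_
  have : x ∈ C' ∪ D' := hCD ▸ mem_univ x
  simp only [mem_compl_iff, mem_inter_iff, mem_union] at hx this ⊢
  tauto

/-- Urysohn's lemma, with values in `ℝ`. -/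
theorem IsNormal.exists_levelSep (hO : O.IsNormal) {C D : Set X} (h : O.Orth C D)
    (hd : Disjoint C D) :
    ∃ f : X → ℝ, O.LevelSep f ∧ (∀ x, f x ∈ Icc (0 : ℝ) 1) ∧ (∀ x ∈ C, f x = 0) ∧
      ∀ x ∈ D, f x = 1 := by
  -- The discrete topology makes every open and closed condition in `CU` vacuous, leaving only the
  -- orthogonality predicate.
  let _ : TopologicalSpace X := ⊥
  have _ : DiscreteTopology X := ⟨rfl⟩
  let c : Urysohns.CU fun C U : Set X => O.Orth C Uᶜ :=
    { C := C
      U := Dᶜ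
      P_C_U := by rwa [compl_compl]
      closed_C := isClosed_discrete _
      open_U := isOpen_discrete _
      subset := subset_compl_iff_disjoint_right.2 hd
      hP := by
        intro c u _ h _ hcu
        obtain ⟨v, h1, h2, h3, h4⟩ := hO.exists_between h hcu
        exact ⟨v, isOpen_discrete _, h1, by simpa using h2, h3, by simpa using h4⟩ }
  exact ⟨c.lim, levelSep_lim c, c.lim_mem_Icc, c.lim_of_mem_C,
    fun x hx => c.lim_of_notMem_U x (by simpa [c] using hx)⟩

/-! ### Continuous functions to the unit interval -/

/-- `⊥`-continuity of functions to `[0,1]`. -/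
abbrev UCont (O : Orthogonality X) (f : X → unitInterval) : Prop :=
  O.Cont (topological unitInterval) f

theorem UCont.levelSep {f : X → unitInterval} (hf : O.UCont f) :
    O.LevelSep fun x => (f x : ℝ) := by
  intro a b hab
  refine hf {t | (t : ℝ) ≤ a} {t | b ≤ (t : ℝ)} ?_
  have h1 : IsClosed {t : unitInterval | (t : ℝ) ≤ a} :=
    isClosed_le continuous_subtype_val continuous_const
  have h2 : IsClosed {t : unitInterval | b ≤ (t : ℝ)} :=
    isClosed_le continuous_const continuous_subtype_val
  change closure _ ∩ closure _ = ∅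
  rw [h1.closure_eq, h2.closure_eq]
  ext t
  simp only [mem_inter_iff, mem_ofPred_eq, mem_empty_iff_false, iff_false, not_and, not_le]
  intro h
  linarith

/-- By compactness of `closure A` it is enough to treat a small ball around one `t`. The points of
`C` keep a distance `ε` from `t`, so they lie above or below, and each side is a pair of separated
levels. -/
theorem LevelSep.uCont {f : X → unitInterval} (hf : O.LevelSep fun x => (f x : ℝ)) :
    O.UCont f := by
  intro A C hAC
  change closure A ∩ closure C = ∅ at hAC
  suffices h : O.Orth (f ⁻¹' closure A) (f ⁻¹' C) from
    h.mono_left (preimage_mono subset_closure)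
  refine (isClosed_closure (s := A)).isCompact.induction_on
    (p := fun S => O.Orth (f ⁻¹' S) (f ⁻¹' C)) (O.orth_empty_left _)
    (fun s t hst h => h.mono_left (preimage_mono hst)) (fun s t hs ht => hs.union_left ht) ?_
  intro t ht
  have htC : t ∉ closure C := fun h =>
    (hAC ▸ (⟨ht, h⟩ : t ∈ closure A ∩ closure C) : t ∈ (∅ : Set _))
  rw [Metric.mem_closure_iff] at htC
  push Not at htC
  obtain ⟨ε, hε, hC⟩ := htC
  refine ⟨Metric.ball t (ε / 2), mem_nhdsWithin_of_mem_nhds (Metric.ball_mem_nhds _ (half_pos hε)),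
    ?_⟩
  have h1 := hf (t + ε / 2) (t + ε) (by linarith)
  have h2 := O.symm (hf (t - ε) (t - ε / 2) (by linarith))
  refine ((h1.mono_left ?_).union_right (h2.mono_left ?_)).mono_right ?_
  · intro x hx
    have hx : |(f x : ℝ) - t| < ε / 2 := hx
    rw [abs_lt] at hx
    simp only [mem_ofPred_eq]; linarith
  · intro x hx
    have hx : |(f x : ℝ) - t| < ε / 2 := hx
    rw [abs_lt] at hx
    simp only [mem_ofPred_eq]; linarith
  · intro x hx
    have hx : ε ≤ |(t : ℝ) - f x| := hC _ hx
    simp only [mem_union, mem_ofPred_eq]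
    rcases le_abs.1 hx with h | h
    · right; linarith
    · left; linarith

/-- Urysohn's lemma. -/
theorem IsNormal.exists_uCont (hO : O.IsNormal) {C D : Set X} (h : O.Orth C D)
    (hd : Disjoint C D) :
    ∃ f : X → unitInterval, O.UCont f ∧ (∀ x ∈ C, f x = 0) ∧ ∀ x ∈ D, f x = 1 := by
  obtain ⟨f, hf, hI, h0, h1⟩ := hO.exists_levelSep h hd
  exact ⟨fun x => ⟨f x, hI x⟩, LevelSep.uCont hf, fun x hx => Subtype.ext (h0 x hx),
    fun x hx => Subtype.ext (h1 x hx)⟩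

theorem UCont.comp {f : X → unitInterval} (hf : O.UCont f) {g : unitInterval → unitInterval}
    (hg : Continuous g) : O.UCont (g ∘ f) := by
  intro A C hAC
  refine hf (g ⁻¹' A) (g ⁻¹' C) (subset_empty_iff.1 ?_)
  change closure A ∩ closure C = ∅ at hAC
  calc closure (g ⁻¹' A) ∩ closure (g ⁻¹' C) ⊆ g ⁻¹' closure A ∩ g ⁻¹' closure C :=
        inter_subset_inter (hg.closure_preimage_subset A) (hg.closure_preimage_subset C)
    _ = ∅ := by rw [← preimage_inter, hAC, preimage_empty]

theorem UCont.sup {f g : X → unitInterval} (hf : O.UCont f) (hg : O.UCont g) :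
    O.UCont fun x => f x ⊔ g x := by
  refine LevelSep.uCont fun a b hab => ?_
  refine Orth.mono_right (D := {x | b ≤ (f x : ℝ)} ∪ {x | b ≤ (g x : ℝ)})
    (Orth.union_right ((hf.levelSep a b hab).mono_left ?_)
      ((hg.levelSep a b hab).mono_left ?_)) ?_
  · intro x hx
    simp at hx ⊢; tauto
  · intro x hx
    simp at hx ⊢; tauto
  · intro x hx
    simpa using hx

theorem UCont.inf {f g : X → unitInterval} (hf : O.UCont f) (hg : O.UCont g) :
    O.UCont fun x => f x ⊓ g x := by
  refine LevelSep.uCont fun a b hab => ?_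
  refine Orth.mono_left (B := {x | (f x : ℝ) ≤ a} ∪ {x | (g x : ℝ) ≤ a})
    (Orth.union_left ((hf.levelSep a b hab).mono_right ?_)
      ((hg.levelSep a b hab).mono_right ?_)) ?_
  · intro x hx
    simp at hx ⊢; tauto
  · intro x hx
    simp at hx ⊢; tauto
  · intro x hx
    simpa using hx

/-! ### Zero-sets and cozero-sets -/

theorem UCont.isZeroSet_preimage {f : X → unitInterval} (hf : O.UCont f) {K : Set unitInterval}
    (hK : IsClosed K) : O.IsZeroSet (f ⁻¹' K) := by
  -- `Metric.infDist` to the empty set is 0 by convention, so the distance function would give the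
  -- wrong zero-set there.
  obtain rfl | hne := K.eq_empty_or_nonempty
  · refine ⟨(fun _ => 1) ∘ f, hf.comp continuous_const, ?_⟩
    ext x; simp
  · refine ⟨(fun t => projIcc 0 1 zero_le_one (Metric.infDist t K)) ∘ f,
      hf.comp (continuous_projIcc.comp (Metric.continuous_infDist_pt K)), ?_⟩
    ext x
    have h : projIcc (0 : ℝ) 1 zero_le_one (Metric.infDist (f x) K) = 0 ↔
        Metric.infDist (f x) K ≤ 0 := projIcc_eq_left zero_lt_one
    rw [mem_preimage, mem_preimage, mem_singleton_iff, Function.comp_apply, h,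
      hK.mem_iff_infDist_zero hne]
    exact ⟨fun h => h.le, fun h => le_antisymm h Metric.infDist_nonneg⟩

theorem UCont.isZeroSet_le {f : X → unitInterval} (hf : O.UCont f) (a : ℝ) :
    O.IsZeroSet {x | (f x : ℝ) ≤ a} :=
  hf.isZeroSet_preimage (K := {t | (t : ℝ) ≤ a})
    (isClosed_le continuous_subtype_val continuous_const)

theorem UCont.isZeroSet_ge {f : X → unitInterval} (hf : O.UCont f) (a : ℝ) :
    O.IsZeroSet {x | a ≤ (f x : ℝ)} :=
  hf.isZeroSet_preimage (K := {t | a ≤ (t : ℝ)})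
    (isClosed_le continuous_const continuous_subtype_val)

theorem isCozeroSet_compl_iff {A : Set X} : O.IsCozeroSet Aᶜ ↔ O.IsZeroSet A := by
  have h : ∀ f : X → unitInterval, (Aᶜ = f ⁻¹' Ioc 0 1 ↔ A = f ⁻¹' {0}) := by
    intro f
    have : f ⁻¹' Ioc 0 1 = (f ⁻¹' {0})ᶜ := by
      ext x
      simp [unitInterval.pos_iff_ne_zero, unitInterval.le_one']
    rw [this, compl_inj_iff]
  simp only [IsCozeroSet, IsZeroSet, h]

theorem isZeroSet_compl_iff {A : Set X} : O.IsZeroSet Aᶜ ↔ O.IsCozeroSet A := by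
  rw [← isCozeroSet_compl_iff, compl_compl]

theorem UCont.isCozeroSet_gt {f : X → unitInterval} (hf : O.UCont f) (a : ℝ) :
    O.IsCozeroSet {x | a < (f x : ℝ)} := by
  rw [← isZeroSet_compl_iff]
  convert hf.isZeroSet_le a using 1
  ext x; simp

theorem UCont.isCozeroSet_lt {f : X → unitInterval} (hf : O.UCont f) (a : ℝ) :
    O.IsCozeroSet {x | (f x : ℝ) < a} := by
  rw [← isZeroSet_compl_iff]
  convert hf.isZeroSet_ge a using 1
  ext x; simp

theorem IsZeroSet.inter {A B : Set X} (hA : O.IsZeroSet A) (hB : O.IsZeroSet B) :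
    O.IsZeroSet (A ∩ B) := by
  obtain ⟨f, hf, rfl⟩ := hA
  obtain ⟨g, hg, rfl⟩ := hB
  refine ⟨_, UCont.sup hf hg, ?_⟩
  ext x
  simp only [mem_inter_iff, mem_preimage, mem_singleton_iff]
  exact (sup_eq_bot_iff (a := f x) (b := g x)).symm

theorem IsZeroSet.union {A B : Set X} (hA : O.IsZeroSet A) (hB : O.IsZeroSet B) :
    O.IsZeroSet (A ∪ B) := by
  obtain ⟨f, hf, rfl⟩ := hA
  obtain ⟨g, hg, rfl⟩ := hB
  refine ⟨_, UCont.inf hf hg, ?_⟩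
  ext x
  simp only [mem_union, mem_preimage, mem_singleton_iff]
  exact (min_eq_bot (a := f x) (b := g x)).symm

theorem IsCozeroSet.inter {A B : Set X} (hA : O.IsCozeroSet A) (hB : O.IsCozeroSet B) :
    O.IsCozeroSet (A ∩ B) := by
  rw [← isZeroSet_compl_iff] at hA hB ⊢
  rw [compl_inter]
  exact hA.union hB

-- Sets with disjoint closures cannot both contain `t`, so one of the two preimages lies in `B` and
-- is orthogonal to everything.
open Classical in
theorem Bdd.uCont_ite {B : Set X} (hB : O.Bdd B) (s t : unitInterval) :
    O.UCont fun x => if x ∈ B then s else t := by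
  intro A C hAC
  by_cases hA : t ∈ A
  · have hC : t ∉ C := fun h => (hAC ▸ (⟨subset_closure hA, subset_closure h⟩ :
      t ∈ closure A ∩ closure C) : t ∈ (∅ : Set _))
    refine O.symm ((hB.mono fun x hx => ?_).orth _)
    by_contra h
    simp only [mem_preimage, if_neg h] at hx
    exact hC hx
  · refine (hB.mono fun x hx => ?_).orth _
    by_contra h
    simp only [mem_preimage, if_neg h] at hx
    exact hA hx

theorem Bdd.isZeroSet {B : Set X} (hB : O.Bdd B) : O.IsZeroSet B := by
  classical
  refine ⟨_, hB.uCont_ite 0 1, ?_⟩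
  ext x; by_cases h : x ∈ B <;> simp [h]

theorem Bdd.isZeroSet_compl {B : Set X} (hB : O.Bdd B) : O.IsZeroSet Bᶜ := by
  classical
  refine ⟨_, hB.uCont_ite 1 0, ?_⟩
  ext x; by_cases h : x ∈ B <;> simp [h]

variable (O) in
theorem isZeroSet_univ : O.IsZeroSet univ := by
  simpa using (O.bdd_empty).isZeroSet_compl

/-! ### Ultrafilters of unbounded zero-sets -/

theorem IsUnboundedZeroFilter.exists_boundary₀ {F : Set (Set X)}
    (hF : O.IsUnboundedZeroFilter F) : ∃ G : O.Boundary₀, F ⊆ G.1 := by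
  suffices h : ∃ G, F ⊆ G ∧ Maximal (· ∈ {F | O.IsUnboundedZeroFilter F}) G by
    obtain ⟨G, hFG, hG⟩ := h
    exact ⟨⟨G, hG⟩, hFG⟩
  refine zorn_subset_nonempty {F | O.IsUnboundedZeroFilter F} ?_ F hF
  rintro c hc hchain ⟨G, hG⟩
  refine ⟨⋃₀ c, ⟨⟨G, hG, (hc hG).univ_mem⟩, ?_, ?_, ?_, ?_⟩, fun s hs => subset_sUnion_of_mem hs⟩
  · rintro Z ⟨H, hH, hZ⟩
    exact (hc hH).isZeroSet Z hZ
  · rintro Z ⟨H, hH, hZ⟩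
    exact (hc hH).unbounded Z hZ
  · rintro Z ⟨H, hH, hZ⟩ W hZW hW
    exact ⟨H, hH, (hc hH).superset Z hZ W hZW hW⟩
  · rintro Z ⟨H, hH, hZ⟩ W ⟨K, hK, hW⟩
    rcases hchain.total hH hK with h | h
    · exact ⟨K, hK, (hc hK).inter Z (h hZ) W hW⟩
    · exact ⟨H, hH, (hc hH).inter Z hZ W (h hW)⟩

namespace Boundary₀

variable (F : O.Boundary₀)

theorem isFilter : O.IsUnboundedZeroFilter F.1 := F.2.prop

variable {F}

/-- The zero-sets containing some `Z ∩ W` form an unbounded filter that extends `F`, so maximality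
gives equality. -/
theorem mem_of_forall {Z : Set X} (hZ : O.IsZeroSet Z) (h : ∀ W ∈ F.1, ¬ O.Bdd (Z ∩ W)) :
    Z ∈ F.1 := by
  have hF := F.isFilter
  have hG : O.IsUnboundedZeroFilter {V | O.IsZeroSet V ∧ ∃ W ∈ F.1, Z ∩ W ⊆ V} := by
    refine ⟨⟨O.isZeroSet_univ, univ, hF.univ_mem, subset_univ _⟩, fun V hV => hV.1, ?_, ?_, ?_⟩
    · rintro V ⟨-, W, hW, hV⟩ hb
      exact h W hW (hb.mono hV)
    · rintro V ⟨-, W, hW, hV⟩ V' hVV' hV'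
      exact ⟨hV', W, hW, hV.trans hVV'⟩
    · rintro V ⟨hV, W, hW, hWV⟩ V' ⟨hV', W', hW', hWV'⟩
      refine ⟨hV.inter hV', W ∩ W', hF.inter _ hW _ hW', subset_inter ?_ ?_⟩
      · exact (inter_subset_inter_right Z inter_subset_left).trans hWV
      · exact (inter_subset_inter_right Z inter_subset_right).trans hWV'
  exact F.2.le_of_ge hG (fun W hW => ⟨hF.isZeroSet W hW, W, hW, inter_subset_right⟩)
    ⟨hZ, univ, hF.univ_mem, inter_subset_left⟩

theorem compl_mem_of_bdd {B : Set X} (hB : O.Bdd B) : Bᶜ ∈ F.1 := by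
  refine mem_of_forall hB.isZeroSet_compl fun W hW h => F.isFilter.unbounded W hW ?_
  refine (hB.union h).mono fun x hx => ?_
  by_cases hxB : x ∈ B
  · exact Or.inl hxB
  · exact Or.inr ⟨hxB, hx⟩

theorem diff_mem_of_bdd {Z B : Set X} (hZ : Z ∈ F.1) (hB : O.Bdd B) : Z \ B ∈ F.1 :=
  F.isFilter.inter _ hZ _ (compl_mem_of_bdd hB)

/-- Maximality only yields a member whose intersection with `Z` is bounded; removing that bounded
set stays in `F` and makes the disjointness exact. -/
theorem exists_disjoint_of_notMem {Z : Set X} (hZ : O.IsZeroSet Z) (h : Z ∉ F.1) :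
    ∃ W ∈ F.1, W ⊆ Zᶜ := by
  by_contra! hW
  refine h (mem_of_forall hZ fun W hWF hb => hW _ (diff_mem_of_bdd hWF hb) ?_)
  rintro x ⟨hxW, hx⟩ hxZ
  exact hx ⟨hxZ, hxW⟩

theorem inter_nonempty {Z W : Set X} (hZ : Z ∈ F.1) (hW : W ∈ F.1) : (Z ∩ W).Nonempty := by
  rw [nonempty_iff_ne_empty]
  intro h
  exact F.isFilter.unbounded _ (F.isFilter.inter _ hZ _ hW) (h ▸ O.bdd_empty)

theorem mem_or_mem {Z W : Set X} (hZ : O.IsZeroSet Z) (hW : O.IsZeroSet W)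
    (h : ∀ x, x ∈ Z ∨ x ∈ W) : Z ∈ F.1 ∨ W ∈ F.1 := by
  by_contra! h'
  obtain ⟨V, hV, hVZ⟩ := exists_disjoint_of_notMem hZ h'.1
  obtain ⟨V', hV', hVW⟩ := exists_disjoint_of_notMem hW h'.2
  obtain ⟨x, hx, hx'⟩ := inter_nonempty hV hV'
  rcases h x with h | h
  · exact hVZ hx h
  · exact hVW hx' h

end Boundary₀

open Boundary₀

/-- A zero-set of `f` that avoids `x` is disjoint from `{y | f x ≤ f y}`, a zero-set through `x` and
hence a member. -/
theorem PrincipalAt.mem_iff {F : O.Boundary₀} {x : X} (h : O.PrincipalAt F x) {Z : Set X} :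
    Z ∈ F.1 ↔ O.IsZeroSet Z ∧ x ∈ Z := by
  refine ⟨fun hZ => ⟨F.isFilter.isZeroSet Z hZ, ?_⟩, fun hZ => h Z hZ.1 hZ.2⟩
  obtain ⟨f, hf, rfl⟩ := F.isFilter.isZeroSet Z hZ
  by_contra hx
  obtain ⟨y, hy, hy'⟩ := inter_nonempty hZ (h _ (UCont.isZeroSet_ge hf (f x)) (le_refl (f x : ℝ)))
  simp only [mem_preimage, mem_singleton_iff, mem_ofPred_eq] at hx hy hy'
  rw [hy] at hy'
  exact hx (le_antisymm hy' unitInterval.nonneg')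

theorem PrincipalAt.eq {F G : O.Boundary₀} {x : X} (hF : O.PrincipalAt F x)
    (hG : O.PrincipalAt G x) : F = G :=
  Subtype.ext (Set.ext fun _ => by rw [hF.mem_iff, hG.mem_iff])

theorem PrincipalAt.not_bdd {F : O.Boundary₀} {x : X} (hF : O.PrincipalAt F x) :
    ¬ O.Bdd {x} :=
  fun h => F.isFilter.unbounded _ (hF _ h.isZeroSet rfl) h

theorem exists_principalAt {x : X} (hx : ¬ O.Bdd {x}) : ∃ F, O.PrincipalAt F x := by
  have : O.IsUnboundedZeroFilter {Z | O.IsZeroSet Z ∧ x ∈ Z} := by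
    refine ⟨⟨O.isZeroSet_univ, mem_univ x⟩, fun Z hZ => hZ.1, ?_, ?_, ?_⟩
    · exact fun Z hZ h => hx (h.mono (singleton_subset_iff.2 hZ.2))
    · exact fun Z hZ W hZW hW => ⟨hW, hZW hZ.2⟩
    · exact fun Z hZ W hW => ⟨hZ.1.inter hW.1, hZ.2, hW.2⟩
  obtain ⟨F, hF⟩ := this.exists_boundary₀
  exact ⟨F, fun Z hZ hx => hF ⟨hZ, hx⟩⟩

theorem Represents.unique_left {F G : O.Boundary₀} {p : O.Precomp} (hF : O.Represents F p)
    (hG : O.Represents G p) : F = G := by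
  rcases p with x | H
  · exact PrincipalAt.eq hF hG
  · exact Eq.trans hF (Eq.symm hG)

theorem exists_represents (F : O.Boundary₀) : ∃ p, O.Represents F p := by
  by_cases h : ∃ x, O.PrincipalAt F x
  · obtain ⟨x, hx⟩ := h
    exact ⟨Sum.inl x, hx⟩
  · push Not at h
    exact ⟨Sum.inr ⟨F, h⟩, rfl⟩

/-! ### Limits of continuous functions along ultrafilters -/

/-- The limit of `f` along the ultrafilter `F`. -/
noncomputable def limit (f : X → unitInterval) (F : O.Boundary₀) : ℝ :=
  sInf {a : ℝ | {x | (f x : ℝ) ≤ a} ∈ F.1}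

section limit

variable {f : X → unitInterval} {F G : O.Boundary₀}

theorem bddBelow_limit (f : X → unitInterval) (F : O.Boundary₀) :
    BddBelow {a : ℝ | {x | (f x : ℝ) ≤ a} ∈ F.1} := by
  refine ⟨0, fun a ha => ?_⟩
  obtain ⟨x, hx, -⟩ := inter_nonempty ha ha
  exact (f x).2.1.trans hx

theorem nonempty_limit (f : X → unitInterval) (F : O.Boundary₀) :
    {a : ℝ | {x | (f x : ℝ) ≤ a} ∈ F.1}.Nonempty := by
  refine ⟨1, ?_⟩
  have : {x | (f x : ℝ) ≤ 1} = univ := eq_univ_of_forall fun x => (f x).2.2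
  simpa only [mem_ofPred_eq, this] using F.isFilter.univ_mem

theorem limit_le {b : ℝ} (h : {x | (f x : ℝ) ≤ b} ∈ F.1) : limit f F ≤ b :=
  csInf_le (bddBelow_limit f F) h

theorem mem_of_limit_lt (hf : O.UCont f) {b : ℝ} (h : limit f F < b) :
    {x | (f x : ℝ) ≤ b} ∈ F.1 := by
  obtain ⟨a, ha, hab⟩ := exists_lt_of_csInf_lt (nonempty_limit f F) h
  exact F.isFilter.superset _ ha _ (fun x hx => le_trans hx hab.le) (hf.isZeroSet_le b)

theorem mem_of_lt_limit (hf : O.UCont f) {b : ℝ} (h : b < limit f F) :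
    {x | b ≤ (f x : ℝ)} ∈ F.1 := by
  rcases mem_or_mem (F := F) (hf.isZeroSet_le b) (hf.isZeroSet_ge b) 
    (fun x => le_total (f x : ℝ) b)
    with h' | h'
  · exact absurd (limit_le h') (not_le.2 h)
  · exact h'

theorem le_limit (hf : O.UCont f) {b : ℝ} (h : {x | b ≤ (f x : ℝ)} ∈ F.1) :
    b ≤ limit f F := by
  by_contra! hb
  obtain ⟨c, hc, hcb⟩ := exists_between hb
  obtain ⟨x, hx, hx'⟩ := inter_nonempty h (mem_of_limit_lt hf hc)
  exact absurd (le_trans hx hx') (not_le.2 hcb)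

theorem Sim.symm (h : O.Sim F G) : O.Sim G F := fun C hC D hD hCD => h D hD C hC (O.symm hCD)

/-- Two levels chosen between different limits would give orthogonal members. -/
theorem Sim.limit_le_limit (h : O.Sim F G) (hf : O.UCont f) : limit f G ≤ limit f F := by
  by_contra! hlt
  obtain ⟨a, ha, hlt'⟩ := exists_between hlt
  obtain ⟨b, hab, hb⟩ := exists_between hlt'
  exact h _ (mem_of_limit_lt hf ha) _ (mem_of_lt_limit hf hb) (hf.levelSep a b hab)

theorem Sim.limit_eq (h : O.Sim F G) (hf : O.UCont f) : limit f F = limit f G :=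
  le_antisymm (h.symm.limit_le_limit hf) (h.limit_le_limit hf)

theorem PrincipalAt.limit_eq {x : X} (h : O.PrincipalAt F x) (hf : O.UCont f) :
    limit f F = f x :=
  le_antisymm (limit_le (h _ (hf.isZeroSet_le _) (le_refl (f x : ℝ))))
    (le_limit hf (h _ (hf.isZeroSet_ge _) (le_refl (f x : ℝ))))

end limit

/-- A continuous function separating two orthogonal sets up to their bounded intersection. -/
theorem IsNormal.exists_uCont_diff (hO : O.IsNormal) {C D : Set X} (h : O.Orth C D) :
    ∃ f : X → unitInterval, O.UCont f ∧ (∀ x ∈ C \ D, f x = 0) ∧ ∀ x ∈ D, f x = 1 :=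
  hO.exists_uCont (h.mono_left sdiff_subset) disjoint_sdiff_left

/-- Ultrafilters with orthogonal members are separated by the limits of a continuous function. -/
theorem IsNormal.exists_limit_of_not_sim (hO : O.IsNormal) {F G : O.Boundary₀}
    (h : ¬ O.Sim F G) :
    ∃ f : X → unitInterval, O.UCont f ∧ limit f F ≤ 0 ∧ 1 ≤ limit f G := by
  simp only [Sim] at h
  push Not at h
  obtain ⟨C, hC, D, hD, hCD⟩ := h
  obtain ⟨f, hf, h0, h1⟩ := hO.exists_uCont_diff hCD
  refine ⟨f, hf, limit_le ?_, le_limit hf ?_⟩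
  · refine F.isFilter.superset _ (diff_mem_of_bdd hC (hO.bdd_inter hCD)) _ ?_ (hf.isZeroSet_le 0)
    intro x hx
    simp [h0 x ⟨hx.1, fun hxD => hx.2 ⟨hx.1, hxD⟩⟩]
  · refine G.isFilter.superset _ hD _ (fun x hx => ?_) (hf.isZeroSet_ge 1)
    simp [h1 x hx]

theorem IsNormal.sim_iff (hO : O.IsNormal) {F G : O.Boundary₀} :
    O.Sim F G ↔ ∀ f, O.UCont f → limit f F = limit f G := by
  refine ⟨fun h f hf => h.limit_eq hf, fun h => ?_⟩
  by_contra hn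
  obtain ⟨f, hf, h0, h1⟩ := hO.exists_limit_of_not_sim hn
  have := h f hf
  linarith

theorem IsNormal.equivalence_sim (hO : O.IsNormal) : Equivalence O.Sim where
  refl _ := hO.sim_iff.2 fun _ _ => rfl
  symm h := h.symm
  trans h h' := hO.sim_iff.2 fun _ hf => (h.limit_eq hf).trans (h'.limit_eq hf)

/-- An ultrafilter equivalent to the principal one at `x` is principal at `x`. -/
theorem PrincipalAt.of_sim {F G : O.Boundary₀} {x : X} (hF : O.PrincipalAt F x)
    (h : O.Sim F G) : O.PrincipalAt G x := by
  intro Z hZ hx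
  by_contra hZG
  -- The zero-set `W` of `g` avoids `x`, so `g` is positive at `x`, its limit along `F`; but its
  -- limit along `G` is 0.
  obtain ⟨W, hW, hWZ⟩ := exists_disjoint_of_notMem hZ hZG
  obtain ⟨g, hg, rfl⟩ := G.isFilter.isZeroSet W hW
  have hxg : (0 : ℝ) < g x := unitInterval.coe_pos.2 <|
    unitInterval.pos_iff_ne_zero.2 fun h0 => hWZ h0 hx
  have h1 := hF.limit_eq hg
  have h2 : limit g G ≤ 0 :=
    limit_le (G.isFilter.superset _ hW _ (fun y hy => by
      simp only [mem_preimage, mem_singleton_iff] at hy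
      simp [hy]) (UCont.isZeroSet_le hg 0))
  have := h.limit_eq hg
  linarith

theorem IsNormal.principalAt_unique (hO : O.IsNormal) {F : O.Boundary₀} {x y : X}
    (hx : O.PrincipalAt F x) (hy : O.PrincipalAt F y) : x = y := by
  by_contra hne
  obtain ⟨f, hf, h0, h1⟩ := hO.exists_uCont (hO.frechet x y hne) (by simpa using hne)
  have h := (hx.limit_eq hf).symm.trans (hy.limit_eq hf)
  rw [h0 x rfl, h1 y rfl] at h
  simp at h

theorem IsNormal.represents_unique_right (hO : O.IsNormal) {F : O.Boundary₀} {p q : O.Precomp}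
    (hp : O.Represents F p) (hq : O.Represents F q) : p = q := by
  rcases p with x | G <;> rcases q with y | H
  · exact congrArg Sum.inl (hO.principalAt_unique hp hq)
  · cases hq
    exact absurd hp (H.2 x)
  · cases hp
    exact absurd hq (G.2 y)
  · exact congrArg Sum.inr (Subtype.ext (Eq.trans (Eq.symm hp) hq))

theorem IsNormal.equivalence_precompRel (hO : O.IsNormal) : Equivalence O.PrecompRel where
  refl _ := Or.inl rfl
  symm := by
    rintro p q (rfl | ⟨F, G, hF, hG, h⟩)
    · exact Or.inl rfl
    · exact Or.inr ⟨G, F, hG, hF, h.symm⟩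
  trans := by
    rintro p q r (rfl | ⟨F, G, hF, hG, h⟩) hqr
    · exact hqr
    · rcases hqr with rfl | ⟨G', H, hG', hH, h'⟩
      · exact Or.inr ⟨F, G, hF, hG, h⟩
      · obtain rfl := hG.unique_left hG'
        exact Or.inr ⟨F, H, hF, hH, hO.equivalence_sim.trans h h'⟩

theorem IsNormal.mk_eq_mk (hO : O.IsNormal) {p q : O.Precomp} :
    (Quot.mk _ p : O.Compactification) = Quot.mk _ q ↔ O.PrecompRel p q := by
  exact Quot.eq.trans hO.equivalence_precompRel.eqvGen_iff

/-- Points of `X` are not identified with other points. -/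
theorem IsNormal.eq_of_precompRel_inl (hO : O.IsNormal) {x : X} {p : O.Precomp}
    (h : O.PrecompRel (Sum.inl x) p) : p = Sum.inl x := by
  rcases h with h | ⟨F, G, hF, hG, h⟩
  · exact h.symm
  · exact hO.represents_unique_right hG (PrincipalAt.of_sim hF h)

theorem IsNormal.mk_eq_toCompactification (hO : O.IsNormal) {p : O.Precomp} {x : X} :
    (Quot.mk _ p : O.Compactification) = O.toCompactification x ↔ p = Sum.inl x := by
  refine ⟨fun h => ?_, fun h => h ▸ rfl⟩
  exact hO.eq_of_precompRel_inl (hO.mk_eq_mk.1 h.symm)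

theorem IsNormal.injective_toCompactification (hO : O.IsNormal) :
    Function.Injective O.toCompactification :=
  fun _ _ h => Sum.inl_injective (hO.mk_eq_toCompactification.1 h)

/-! ### The topology -/

theorem inl_mem_bar {x : X} {C : Set X} : (Sum.inl x : O.Precomp) ∈ O.bar C ↔ x ∈ C := by
  constructor
  · rintro (⟨y, hy, h⟩ | ⟨F, hF, Z, hZ, hZC⟩)
    · exact Sum.inl_injective h ▸ hy
    · exact hZC ((PrincipalAt.mem_iff hF).1 hZ).2
  · exact fun h => Or.inl ⟨x, h, rfl⟩

theorem inr_mem_bar {G : {F : O.Boundary₀ // ∀ x : X, ¬ O.PrincipalAt F x}} {C : Set X} :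
    (Sum.inr G : O.Precomp) ∈ O.bar C ↔ ∃ Z ∈ G.1.1, Z ⊆ C := by
  constructor
  · rintro (⟨y, hy, h⟩ | ⟨F, hF, h⟩)
    · cases h
    · cases hF
      exact h
  · exact fun h => Or.inr ⟨G.1, rfl, h⟩

theorem mem_bar_inter {p : O.Precomp} {C D : Set X} (hC : p ∈ O.bar C) (hD : p ∈ O.bar D) :
    p ∈ O.bar (C ∩ D) := by
  rcases p with x | G
  · exact inl_mem_bar.2 ⟨inl_mem_bar.1 hC, inl_mem_bar.1 hD⟩
  · obtain ⟨Z, hZ, hZC⟩ := inr_mem_bar.1 hC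
    obtain ⟨W, hW, hWD⟩ := inr_mem_bar.1 hD
    exact inr_mem_bar.2 ⟨Z ∩ W, G.1.isFilter.inter _ hZ _ hW, inter_subset_inter hZC hWD⟩

theorem bar_mono {C D : Set X} (h : C ⊆ D) : O.bar C ⊆ O.bar D := by
  rintro (x | G) hp
  · exact inl_mem_bar.2 (h (inl_mem_bar.1 hp))
  · obtain ⟨Z, hZ, hZC⟩ := inr_mem_bar.1 hp
    exact inr_mem_bar.2 ⟨Z, hZ, hZC.trans h⟩

theorem bar_univ : O.bar univ = univ := by
  refine eq_univ_of_forall ?_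
  rintro (x | G)
  · exact inl_mem_bar.2 (mem_univ x)
  · exact inr_mem_bar.2 ⟨univ, G.1.isFilter.univ_mem, subset_rfl⟩

variable (O) in
theorem isCozeroSet_univ : O.IsCozeroSet univ := by
  rw [← isZeroSet_compl_iff, compl_univ]
  exact O.bdd_empty.isZeroSet

variable (O) in
theorem isTopologicalBasis_bar : TopologicalSpace.IsTopologicalBasis
    {V : Set O.Precomp | ∃ U : Set X, O.IsCozeroSet U ∧ V = O.bar U} where
  exists_subset_inter := by
    rintro _ ⟨U, hU, rfl⟩ _ ⟨V, hV, rfl⟩ p ⟨hp, hp'⟩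
    exact ⟨_, ⟨U ∩ V, hU.inter hV, rfl⟩, mem_bar_inter hp hp',
      subset_inter (bar_mono inter_subset_left) (bar_mono inter_subset_right)⟩
  sUnion_eq := eq_univ_of_univ_subset
    (subset_sUnion_of_mem ⟨univ, O.isCozeroSet_univ, bar_univ.symm⟩)
  eq_generateFrom := rfl

theorem IsCozeroSet.isOpen_bar {U : Set X} (hU : O.IsCozeroSet U) : IsOpen (O.bar U) :=
  O.isTopologicalBasis_bar.isOpen ⟨U, hU, rfl⟩

theorem bar_of_bdd {B : Set X} (hB : O.Bdd B) : O.bar B = Sum.inl '' B := by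
  ext (x | G)
  · refine inl_mem_bar.trans ?_
    exact ⟨fun h => ⟨x, h, rfl⟩, fun ⟨y, hy, h⟩ => Sum.inl_injective h ▸ hy⟩
  · refine inr_mem_bar.trans ?_
    constructor
    · rintro ⟨Z, hZ, hZB⟩
      exact absurd (hB.mono hZB) (G.1.isFilter.unbounded Z hZ)
    · rintro ⟨y, -, h⟩
      cases h

theorem bar_compl_of_bdd {B : Set X} (hB : O.Bdd B) : O.bar Bᶜ = (O.bar B)ᶜ := by
  ext (x | G)
  · exact inl_mem_bar.trans (not_congr inl_mem_bar).symm
  · refine iff_of_true (inr_mem_bar.2 ⟨_, compl_mem_of_bdd hB, subset_rfl⟩) fun h => ?_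
    obtain ⟨Z, hZ, hZB⟩ := inr_mem_bar.1 h
    exact G.1.isFilter.unbounded Z hZ (hB.mono hZB)

theorem IsNormal.preimage_mk_image (hO : O.IsNormal) (B : Set X) :
    (Quot.mk O.PrecompRel : O.Precomp → O.Compactification) ⁻¹' (O.toCompactification '' B) =
      Sum.inl '' B := by
  ext p
  constructor
  · rintro ⟨x, hx, h⟩
    exact ⟨x, hx, (hO.mk_eq_toCompactification.1 h.symm).symm⟩
  · rintro ⟨x, hx, rfl⟩
    exact ⟨x, hx, rfl⟩

theorem continuous_mk :
    Continuous (Quot.mk O.PrecompRel : O.Precomp → O.Compactification) :=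
  continuous_quot_mk

/-- Bounded sets are open and closed in the compactification. -/
theorem IsNormal.isClopen_image (hO : O.IsNormal) {B : Set X} (hB : O.Bdd B) :
    IsClopen (O.toCompactification '' B) := by
  have hq : IsQuotientMap (Quot.mk O.PrecompRel : O.Precomp → O.Compactification) :=
    isQuotientMap_quot_mk
  refine hq.isClopen_preimage.1 ?_
  suffices h : IsClopen (O.bar B) by
    rwa [bar_of_bdd hB, ← hO.preimage_mk_image] at h
  refine ⟨⟨?_⟩, (isZeroSet_compl_iff.1 hB.isZeroSet_compl).isOpen_bar⟩
  rw [← bar_compl_of_bdd hB]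
  exact (isCozeroSet_compl_iff.2 hB.isZeroSet).isOpen_bar

/-! ### Extension of continuous functions -/

/-- The extension of a function to `X ∪ ∂₀X` by its limits along ultrafilters. -/
noncomputable def preExt (f : X → unitInterval) : O.Precomp → ℝ :=
  Sum.elim (fun x => (f x : ℝ)) fun G => limit f G.1

section preExt

variable {f : X → unitInterval}

theorem Represents.preExt_eq {F : O.Boundary₀} {p : O.Precomp} (h : O.Represents F p)
    (hf : O.UCont f) : preExt f p = limit f F := by
  rcases p with x | G
  · exact (PrincipalAt.limit_eq h hf).symm
  · cases h
    rfl

theorem PrecompRel.preExt_eq {p q : O.Precomp} (h : O.PrecompRel p q) (hf : O.UCont f) :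
    preExt f p = preExt f q := by
  rcases h with rfl | ⟨F, G, hF, hG, h⟩
  · rfl
  · rw [hF.preExt_eq hf, hG.preExt_eq hf, h.limit_eq hf]

theorem mem_bar_gt (hf : O.UCont f) {p : O.Precomp} {a : ℝ} (h : a < preExt f p) :
    p ∈ O.bar {x | a < (f x : ℝ)} := by
  rcases p with x | G
  · exact inl_mem_bar.2 h
  · obtain ⟨b, hab, hb⟩ := exists_between h
    exact inr_mem_bar.2 ⟨_, mem_of_lt_limit hf hb, fun x hx => lt_of_lt_of_le hab hx⟩

theorem mem_bar_lt (hf : O.UCont f) {p : O.Precomp} {a : ℝ} (h : preExt f p < a) :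
    p ∈ O.bar {x | (f x : ℝ) < a} := by
  rcases p with x | G
  · exact inl_mem_bar.2 h
  · obtain ⟨b, hb, hba⟩ := exists_between h
    exact inr_mem_bar.2 ⟨_, mem_of_limit_lt hf hb, fun x hx => lt_of_le_of_lt hx hba⟩

theorem le_preExt (hf : O.UCont f) {p : O.Precomp} {a : ℝ}
    (h : p ∈ O.bar {x | a < (f x : ℝ)}) : a ≤ preExt f p := by
  rcases p with x | G
  · exact (inl_mem_bar.1 h).le
  · obtain ⟨Z, hZ, hZa⟩ := inr_mem_bar.1 h
    exact le_limit hf (G.1.isFilter.superset _ hZ _ (fun x hx => le_of_lt (show a < f x from hZa hx))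
      (hf.isZeroSet_ge a))

theorem preExt_le (hf : O.UCont f) {p : O.Precomp} {a : ℝ}
    (h : p ∈ O.bar {x | (f x : ℝ) < a}) : preExt f p ≤ a := by
  rcases p with x | G
  · exact (inl_mem_bar.1 h).le
  · obtain ⟨Z, hZ, hZa⟩ := inr_mem_bar.1 h
    exact limit_le (G.1.isFilter.superset _ hZ _ (fun x hx => le_of_lt (show f x < a from hZa hx))
      (hf.isZeroSet_le a))

theorem continuous_preExt (hf : O.UCont f) : Continuous (preExt f : O.Precomp → ℝ) := by
  refine continuous_iff_continuousAt.2 fun p => tendsto_order.2 ⟨fun a ha => ?_, fun a ha => ?_⟩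
  -- Membership in `bar` of a strict level set bounds the limit only weakly, hence the intermediate
  -- `b`.
  · obtain ⟨b, hab, hb⟩ := exists_between ha
    filter_upwards [(hf.isCozeroSet_gt b).isOpen_bar.mem_nhds (mem_bar_gt hf hb)] with q hq
    exact lt_of_lt_of_le hab (le_preExt hf hq)
  · obtain ⟨b, hb, hba⟩ := exists_between ha
    filter_upwards [(hf.isCozeroSet_lt b).isOpen_bar.mem_nhds (mem_bar_lt hf hb)] with q hq
    exact lt_of_le_of_lt (preExt_le hf hq) hba

end preExt

/-- Every continuous function extends continuously to the compactification. -/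
theorem UCont.exists_extension {f : X → unitInterval} (hf : O.UCont f) :
    ∃ g : O.Compactification → ℝ, Continuous g ∧ ∀ p, g (Quot.mk _ p) = preExt f p :=
  ⟨Quot.lift (preExt f) fun _ _ h => PrecompRel.preExt_eq h hf,
    continuous_quot_lift _ (continuous_preExt hf), fun _ => rfl⟩

/-! ### The main properties of the compactification -/

theorem IsNormal.t2Space (hO : O.IsNormal) : T2Space O.Compactification := by
  refine ⟨fun a b hab => ?_⟩
  have hbdd : ∀ x : X, O.Bdd {x} → IsClopen {O.toCompactification x} := fun x hx => by
    simpa using hO.isClopen_image hx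
  -- Points of `X` with bounded singleton are isolated; all other points come from ultrafilters and
  -- are separated by extended functions.
  have hrep : ∀ p : O.Precomp, (∃ x, O.Bdd {x} ∧ p = Sum.inl x) ∨ ∃ F, O.Represents F p := by
    rintro (x | G)
    · by_cases hx : O.Bdd {x}
      · exact Or.inl ⟨x, hx, rfl⟩
      · exact Or.inr (exists_principalAt hx)
    · exact Or.inr ⟨G.1, rfl⟩
  obtain ⟨p, rfl⟩ := Quot.exists_rep a
  obtain ⟨q, rfl⟩ := Quot.exists_rep b
  rcases hrep p with ⟨x, hx, rfl⟩ | ⟨F, hF⟩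
  · exact ⟨_, _, (hbdd x hx).isOpen, (hbdd x hx).compl.isOpen, rfl, fun h => hab h.symm,
      disjoint_compl_right⟩
  rcases hrep q with ⟨x, hx, rfl⟩ | ⟨G, hG⟩
  · exact ⟨_, _, (hbdd x hx).compl.isOpen, (hbdd x hx).isOpen, hab, rfl, disjoint_compl_left⟩
  have hFG : ¬ O.Sim F G := fun h => hab (hO.mk_eq_mk.2 (Or.inr ⟨F, G, hF, hG, h⟩))
  obtain ⟨f, hf, h0, h1⟩ := hO.exists_limit_of_not_sim hFG
  obtain ⟨g, hg, hgf⟩ := hf.exists_extension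
  refine separated_by_continuous hg ?_
  rw [hgf, hgf, hF.preExt_eq hf, hG.preExt_eq hf]
  linarith

theorem IsNormal.isLargeScaleSpace (hO : O.IsNormal) :
    IsLargeScaleSpace O.Compactification
      {S | ∃ B : Set X, O.Bdd B ∧ S = O.toCompactification '' B} where
  subset := by
    rintro _ ⟨B, hB, rfl⟩ S hS
    obtain ⟨B', hB', rfl⟩ := subset_image_iff.1 hS
    exact ⟨B', hB.mono hB', rfl⟩
  union := by
    rintro _ ⟨B, hB, rfl⟩ _ ⟨B', hB', rfl⟩
    exact ⟨B ∪ B', hB.union hB', (image_union _ _ _).symm⟩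
  isClopen := by
    rintro _ ⟨B, hB, rfl⟩
    exact hO.isClopen_image hB

/-- A family of zero-sets with unbounded finite intersections lies in an ultrafilter. -/
theorem exists_boundary₀_of_finite_inter {S : Set (Set X)} (hS : ∀ Z ∈ S, O.IsZeroSet Z)
    (h : ∀ T ⊆ S, T.Finite → ¬ O.Bdd (⋂₀ T)) : ∃ F : O.Boundary₀, S ⊆ F.1 := by
  have : O.IsUnboundedZeroFilter
      {Z | O.IsZeroSet Z ∧ ∃ T ⊆ S, T.Finite ∧ ⋂₀ T ⊆ Z} := by
    refine ⟨⟨O.isZeroSet_univ, ∅, empty_subset _, finite_empty, subset_univ _⟩,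
      fun Z hZ => hZ.1, ?_, ?_, ?_⟩
    · rintro Z ⟨-, T, hT, hfin, hTZ⟩ hb
      exact h T hT hfin (hb.mono hTZ)
    · rintro Z ⟨-, T, hT, hfin, hTZ⟩ W hZW hW
      exact ⟨hW, T, hT, hfin, hTZ.trans hZW⟩
    · rintro Z ⟨hZ, T, hT, hfin, hTZ⟩ W ⟨hW, T', hT', hfin', hTW⟩
      refine ⟨hZ.inter hW, T ∪ T', union_subset hT hT', hfin.union hfin', ?_⟩
      rw [sInter_union]
      exact inter_subset_inter hTZ hTW
  obtain ⟨F, hF⟩ := this.exists_boundary₀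
  exact ⟨F, fun Z hZ => hF ⟨hS Z hZ, {Z}, singleton_subset_iff.2 hZ, finite_singleton Z,
    by simp⟩⟩

/-- A zero-set in an ultrafilter keeps its point out of the open set `bar Zᶜ`. -/
theorem Represents.notMem_bar_compl {F : O.Boundary₀} {p : O.Precomp} (h : O.Represents F p)
    {Z : Set X} (hZ : Z ∈ F.1) : p ∉ O.bar Zᶜ := by
  rcases p with x | G
  · exact fun hx => inl_mem_bar.1 hx ((PrincipalAt.mem_iff h).1 hZ).2
  · cases h
    intro hG
    obtain ⟨W, hW, hWZ⟩ := inr_mem_bar.1 hG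
    obtain ⟨x, hx, hx'⟩ := inter_nonempty hW hZ
    exact hWZ hx hx'

/-- The sets `bar Zᶜ`, for finitely many zero-sets `Z` with bounded intersection, leave out only
points of that intersection. -/
theorem mem_image_of_forall_notMem_bar {T : Set (Set X)} (hT : ∀ Z ∈ T, O.IsZeroSet Z)
    (hfin : T.Finite) (hb : O.Bdd (⋂₀ T)) {p : O.Precomp} (hp : ∀ Z ∈ T, p ∉ O.bar Zᶜ) :
    p ∈ Sum.inl '' ⋂₀ T := by
  rcases p with x | G
  · refine ⟨x, fun Z hZ => ?_, rfl⟩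
    by_contra hx
    exact hp Z hZ (inl_mem_bar.2 hx)
  · have hTG : T ⊆ G.1.1 := by
      intro Z hZ
      by_contra hZG
      exact hp Z hZ (inr_mem_bar.2 (exists_disjoint_of_notMem (hT Z hZ) hZG))
    refine absurd hb (G.1.isFilter.unbounded _ ?_)
    clear hp hb hT
    induction T, hfin using Set.Finite.induction_on with
    | empty => simpa using G.1.isFilter.univ_mem
    | insert _ _ ih =>
      rw [sInter_insert]
      exact G.1.isFilter.inter _ (hTG (mem_insert _ _)) _ (ih ((subset_insert _ _).trans hTG))

theorem IsNormal.isLargeScaleCompact (hO : O.IsNormal) :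
    IsLargeScaleCompact O.Compactification
      {S | ∃ B : Set X, O.Bdd B ∧ S = O.toCompactification '' B} where
  toIsLargeScaleSpace := hO.isLargeScaleSpace
  finite_cover := by
    intro 𝒰 hopen hcover
    let mk : O.Precomp → O.Compactification := Quot.mk O.PrecompRel
    let S : Set (Set X) := {Z | O.IsZeroSet Z ∧ ∃ V ∈ 𝒰, O.bar Zᶜ ⊆ mk ⁻¹' V}
    -- Otherwise some ultrafilter contains all of `S`. A basic neighbourhood `bar U` of its point
    -- inside a cover member puts `Uᶜ` into `S`, hence into the ultrafilter, which keeps the point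
    -- out of `bar U`.
    have hex : ∃ T ⊆ S, T.Finite ∧ O.Bdd (⋂₀ T) := by
      by_contra! hne
      obtain ⟨F, hF⟩ := exists_boundary₀_of_finite_inter (O := O) (S := S) (fun Z hZ => hZ.1) hne
      obtain ⟨p, hp⟩ := exists_represents F
      obtain ⟨V, hV, hpV⟩ : mk p ∈ ⋃₀ 𝒰 := hcover ▸ mem_univ _
      obtain ⟨_, ⟨U, hU, rfl⟩, hpU, hUV⟩ := O.isTopologicalBasis_bar.exists_subset_of_mem_open
        (show p ∈ mk ⁻¹' V from hpV) ((hopen V hV).preimage continuous_mk)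
      refine hp.notMem_bar_compl (Z := Uᶜ) (hF ⟨isZeroSet_compl_iff.2 hU, V, hV, ?_⟩) ?_ <;>
        rwa [compl_compl]
    obtain ⟨T, hTS, hfin, hb⟩ := hex
    have hV : ∀ Z ∈ T, ∃ V ∈ 𝒰, O.bar Zᶜ ⊆ mk ⁻¹' V := fun Z hZ => (hTS hZ).2
    choose! V hV𝒰 hVbar using hV
    refine ⟨V '' T, image_subset_iff.2 hV𝒰, hfin.image V,
      hO.isLargeScaleSpace.subset _ ⟨_, hb, rfl⟩ _ fun a ha => ?_⟩
    obtain ⟨p, rfl⟩ := Quot.exists_rep a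
    obtain ⟨x, hx, rfl⟩ := mem_image_of_forall_notMem_bar (fun Z hZ => (hTS hZ).1) hfin hb
      (p := p) fun Z hZ hp => ha ⟨V Z, mem_image_of_mem V hZ, hVbar Z hZ hp⟩
    exact ⟨x, hx, rfl⟩

/-- The closures of orthogonal sets meet only in their intersection. -/
theorem IsNormal.closure_inter_closure_subset (hO : O.IsNormal) {C D : Set X} (h : O.Orth C D) :
    closure (O.toCompactification '' C) ∩ closure (O.toCompactification '' D) ⊆
      O.toCompactification '' (C ∩ D) := by
  obtain ⟨f, hf, h0, h1⟩ := hO.exists_uCont_diff h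
  obtain ⟨g, hg, hgf⟩ := hf.exists_extension
  have hgx : ∀ x, g (O.toCompactification x) = f x := fun x => hgf _
  rintro a ⟨haC, haD⟩
  -- The image of the bounded set `C ∩ D` is its own closure; it remains to exclude the closure of
  -- `C \ D`, where `f` vanishes.
  rw [← sdiff_union_inter C D, image_union, closure_union,
    (hO.isClopen_image (hO.bdd_inter h)).isClosed.closure_eq] at haC
  refine haC.resolve_left fun ha => ?_
  have hg0 : g a = 0 := by
    refine closure_minimal (t := {a | g a = 0}) ?_ (isClosed_eq hg continuous_const) ha
    rintro _ ⟨x, hx, rfl⟩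
    simp [hgx, h0 x hx]
  have hg1 : g a = 1 := by
    refine closure_minimal (t := {a | g a = 1}) ?_ (isClosed_eq hg continuous_const) haD
    rintro _ ⟨x, hx, rfl⟩
    simp [hgx, h1 x hx]
  rw [hg0] at hg1
  exact zero_ne_one hg1

/-- For a set outside an ideal there is an ultrafilter that contains it and misses the ideal. -/
theorem exists_ultrafilter_disjoint_ideal {p : Set X → Prop} (he : p ∅)
    (hmono : ∀ t, p t → ∀ s ⊆ t, p s) (hunion : ∀ s, p s → ∀ t, p t → p (s ∪ t))
    {C : Set X} (hC : ¬ p C) : ∃ 𝓤 : Ultrafilter X, C ∈ 𝓤 ∧ ∀ A ∈ 𝓤, ¬ p A := by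
  have : (Filter.comk p he hmono hunion ⊓ 𝓟 C).NeBot := by
    rw [inf_principal_neBot_iff]
    intro U hU
    by_contra hne
    rw [not_nonempty_iff_eq_empty] at hne
    refine hC (hmono _ hU C fun x hx hxU => ?_)
    exact (hne ▸ (⟨hxU, hx⟩ : x ∈ U ∩ C) : x ∈ (∅ : Set X))
  have hle := Ultrafilter.of_le (Filter.comk p he hmono hunion ⊓ 𝓟 C)
  refine ⟨Ultrafilter.of (Filter.comk p he hmono hunion ⊓ 𝓟 C),
    hle (mem_inf_of_right (mem_principal_self C)), fun A hA hpA => ?_⟩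
  have : Aᶜ ∈ Filter.comk p he hmono hunion := by simpa using hpA
  exact Ultrafilter.compl_mem_iff_notMem.1 (hle (mem_inf_of_left this)) hA

/-- The zero-sets in an ultrafilter of unbounded sets extend to an ultrafilter of zero-sets. -/
theorem exists_boundary₀_of_ultrafilter {𝓤 : Ultrafilter X} (h : ∀ A ∈ 𝓤, ¬ O.Bdd A) :
    ∃ F : O.Boundary₀, ∀ Z, O.IsZeroSet Z → Z ∈ 𝓤 → Z ∈ F.1 := by
  have : O.IsUnboundedZeroFilter {Z | O.IsZeroSet Z ∧ Z ∈ 𝓤} := by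
    refine ⟨⟨O.isZeroSet_univ, univ_mem⟩, fun Z hZ => hZ.1, fun Z hZ => h Z hZ.2, ?_, ?_⟩
    · exact fun Z hZ W hZW hW => ⟨hW, mem_of_superset hZ.2 hZW⟩
    · exact fun Z hZ W hW => ⟨hZ.1.inter hW.1, inter_mem hZ.2 hW.2⟩
  obtain ⟨F, hF⟩ := this.exists_boundary₀
  exact ⟨F, fun Z hZ hZ𝓤 => hF ⟨hZ, hZ𝓤⟩⟩

/-- If a basic neighbourhood `bar U` missed `C`, the zero-set `Uᶜ` would contain `C` and so belong
to `F`, keeping the point out of `bar U`. -/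
theorem Represents.mem_closure {F : O.Boundary₀} {p : O.Precomp} (hp : O.Represents F p)
    {C : Set X} (hF : ∀ Z, O.IsZeroSet Z → C ⊆ Z → Z ∈ F.1) :
    (Quot.mk _ p : O.Compactification) ∈ closure (O.toCompactification '' C) := by
  have hpC : p ∈ closure (Sum.inl '' C : Set O.Precomp) := by
    rw [O.isTopologicalBasis_bar.mem_closure_iff]
    rintro _ ⟨U, hU, rfl⟩ hpU
    by_contra hne
    refine hp.notMem_bar_compl (hF Uᶜ (isZeroSet_compl_iff.2 hU) fun x hx hxU => ?_)
      (by rwa [compl_compl])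
    exact hne ⟨Sum.inl x, inl_mem_bar.2 hxU, x, hx, rfl⟩
  refine closure_mono ?_
    (image_closure_subset_closure_image (continuous_mk (O := O)) (mem_image_of_mem _ hpC))
  rintro _ ⟨_, ⟨x, hx, rfl⟩, rfl⟩
  exact ⟨x, hx, rfl⟩

/-- Ultrafilters of sets without orthogonal members yield equivalent ultrafilters of zero-sets. -/
theorem IsNormal.sim_of_ultrafilter (hO : O.IsNormal) {𝓤 𝓥 : Ultrafilter X}
    (h : ∀ A ∈ 𝓤, ∀ B ∈ 𝓥, ¬ O.Orth A B) {F G : O.Boundary₀}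
    (hF : ∀ Z, O.IsZeroSet Z → Z ∈ 𝓤 → Z ∈ F.1) (hG : ∀ Z, O.IsZeroSet Z → Z ∈ 𝓥 → Z ∈ G.1) :
    O.Sim F G := by
  by_contra hn
  obtain ⟨f, hf, h0, h1⟩ := hO.exists_limit_of_not_sim hn
  -- Any two levels `a < b` strictly between the limits 0 and 1 would serve.
  have hU : {x | (f x : ℝ) ≤ 1 / 3} ∈ 𝓤 := by
    by_contra hU
    have hU' : {x | 1 / 3 ≤ (f x : ℝ)} ∈ 𝓤 :=
      mem_of_superset (Ultrafilter.compl_mem_iff_notMem.2 hU) fun x hx =>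
        (not_le.1 (show ¬ (f x : ℝ) ≤ 1 / 3 from hx)).le
    have := le_limit hf (hF _ (hf.isZeroSet_ge _) hU')
    linarith
  have hV : {x | 2 / 3 ≤ (f x : ℝ)} ∈ 𝓥 := by
    by_contra hV
    have hV' : {x | (f x : ℝ) ≤ 2 / 3} ∈ 𝓥 :=
      mem_of_superset (Ultrafilter.compl_mem_iff_notMem.2 hV) fun x hx =>
        (not_le.1 (show ¬ 2 / 3 ≤ (f x : ℝ) from hx)).le
    have := limit_le (hG _ (hf.isZeroSet_le _) hV')
    linarith
  exact h _ hU _ hV (hf.levelSep _ _ (by norm_num))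

/-- The closures of sets that are not orthogonal share the class of an ultrafilter. -/
theorem IsNormal.exists_mem_closure_of_not_orth (hO : O.IsNormal) {C D : Set X}
    (h : ¬ O.Orth C D) : ∃ (F : O.Boundary₀) (p : O.Precomp), O.Represents F p ∧
      (Quot.mk _ p : O.Compactification) ∈ closure (O.toCompactification '' C) ∧
      (Quot.mk _ p : O.Compactification) ∈ closure (O.toCompactification '' D) := by
  obtain ⟨𝓤, hC, h𝓤⟩ := exists_ultrafilter_disjoint_ideal (p := fun A => O.Orth A D)
    (O.orth_empty_left D) (fun _ ht _ hs => ht.mono_left hs) (fun _ hs _ ht => hs.union_left ht) h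
  -- The sets orthogonal to some member of `𝓤` form an ideal because `𝓤` is closed under
  -- intersections; `D` lies outside it by the choice of `𝓤`. Bounded sets belong to both ideals, so
  -- the members of `𝓤` and `𝓥` are unbounded.
  obtain ⟨𝓥, hD, h𝓥⟩ := exists_ultrafilter_disjoint_ideal
    (p := fun B => ∃ A ∈ 𝓤, O.Orth A B) (C := D) ⟨C, hC, O.orth_empty_right C⟩
    (fun _ ⟨A, hA, hAt⟩ _ hs => ⟨A, hA, hAt.mono_right hs⟩)
    (fun _ ⟨A, hA, hAs⟩ _ ⟨A', hA', hAt⟩ => ⟨A ∩ A', inter_mem hA hA',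
      (hAs.mono_left inter_subset_left).union_right (hAt.mono_left inter_subset_right)⟩)
    (fun ⟨A, hA, hAD⟩ => h𝓤 A hA hAD)
  obtain ⟨F, hF⟩ := exists_boundary₀_of_ultrafilter fun A hA hb => h𝓤 A hA (Bdd.orth hb D)
  obtain ⟨G, hG⟩ := exists_boundary₀_of_ultrafilter (O := O) (𝓤 := 𝓥)
    fun B hB hb => h𝓥 B hB ⟨C, hC, O.symm (hb.orth C)⟩
  have hFG : O.Sim F G :=
    hO.sim_of_ultrafilter (fun A hA B hB hAB => h𝓥 B hB ⟨A, hA, hAB⟩) hF hG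
  obtain ⟨p, hp⟩ := exists_represents F
  obtain ⟨q, hq⟩ := exists_represents G
  refine ⟨F, p, hp, hp.mem_closure fun Z hZ hCZ => hF Z hZ (mem_of_superset hC hCZ), ?_⟩
  rw [hO.mk_eq_mk.2 (Or.inr ⟨F, G, hp, hq, hFG⟩)]
  exact hq.mem_closure fun Z hZ hDZ => hG Z hZ (mem_of_superset hD hDZ)

theorem IsNormal.orth_iff_closure (hO : O.IsNormal) (C D : Set X) : O.Orth C D ↔
    closure (O.toCompactification '' C) ∩ closure (O.toCompactification '' D) ⊆
        Set.range O.toCompactification ∧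
      O.Bdd (O.toCompactification ⁻¹'
        (closure (O.toCompactification '' C) ∩ closure (O.toCompactification '' D))) := by
  constructor
  · intro h
    have hsub := hO.closure_inter_closure_subset h
    refine ⟨hsub.trans (image_subset_range _ _), (hO.bdd_inter h).mono ?_⟩
    rw [← preimage_image_eq (C ∩ D) hO.injective_toCompactification]
    exact preimage_mono hsub
  · rintro ⟨hrange, hb⟩
    by_contra h
    -- The common closure point represents an ultrafilter, so if it is a point of `X`, its singleton
    -- is unbounded.
    obtain ⟨F, p, hp, hpC, hpD⟩ := hO.exists_mem_closure_of_not_orth h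
    obtain ⟨x, hx⟩ := hrange ⟨hpC, hpD⟩
    obtain rfl := hO.mk_eq_toCompactification.1 hx.symm
    exact PrincipalAt.not_bdd hp (hb.mono (singleton_subset_iff.2 ⟨hpC, hpD⟩))

end Orthogonality

theorem proposition13p14 {X : Type u} (O : Orthogonality X) (hO : O.IsNormal) :
    Equivalence O.Sim ∧
    Equivalence O.PrecompRel ∧
    Function.Injective O.toCompactification ∧
    IsLargeScaleCompact O.Compactification
      {S | ∃ B : Set X, O.Bdd B ∧ S = O.toCompactification '' B} ∧
    T2Space O.Compactification ∧
    ∀ C D : Set X, O.Orth C D ↔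
      closure (O.toCompactification '' C) ∩ closure (O.toCompactification '' D) ⊆
          Set.range O.toCompactification ∧
        O.Bdd (O.toCompactification ⁻¹'
          (closure (O.toCompactification '' C) ∩ closure (O.toCompactification '' D))) :=
  ⟨hO.equivalence_sim, hO.equivalence_precompRel, hO.injective_toCompactification,
    hO.isLargeScaleCompact, hO.t2Space, hO.orth_iff_closure⟩
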